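/- Let $n \ge 0$ and $[n] = \{1,\dots,n\}$. An injective word over $[n]$ is a finite sequence (possibly empty) of distinct elements of $[n]$; its content is the set of its letters. Let $L(\Gamma_n)$ be the real vector space of chains, i.e. of formal real linear combinations of injective words over $[n]$, and for $A \subseteq [n]$ let $L(\Gamma(A))$ be the subspace spanned by the words with content exactly $A$. For $a \in [n]$ let $\varrho_a : L(\Gamma_n) \to L(\Gamma_n)$ be the linear operator that sends a word to the word obtained by deleting the letter $a$ (and fixes the words in which $a$ does not occur), and put $$H_A = \{x \in L(\Gamma(A)) : \varrho_a(x) = 0 \text{ for all } a \in A\}.$$ The concatenation product on $L(\Gamma_n)$ is the bilinear operation that sends a pair of words $(\pi,\pi')$ to the word $\pi\pi'$ if $\pi$ and $\pi'$ have disjoint contents, and to $0$ otherwise; put $x \diamond y = xy - yx$. For a permutation $\tau$ of $[n]$, let $\operatorname{supp}(\tau) = \{i : \tau(i) \ne i\}$, and write $\tau$ in standard cycle form: as a product of disjoint cycles $(a_1\, a_2 \dots a_m)$, $m \ge 2$, $\tau(a_i) = a_{i+1}$, $\tau(a_m)=a_1$, each written with its minimum first, the cycles being arranged from left to right by increasing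 minima (fixed points are omitted). The chain $x_\tau$ is the output of the following algorithm. First insert the symbol $\star$ between any two consecutive letters of each cycle. Then, as long as there is a symbol $\star$ in the string, choose the $\star$ whose right-hand neighbor (the letter immediately to its right, disregarding parentheses) is largest; if it stands between the quantities $Q$ and $R$, i.e. appears as $Q \star R$, replace $Q \star R$ by $(Q \diamond R)$. When no $\star$ is left, $x_\tau \in L(\Gamma_n)$ is obtained by expanding all diamond operations and taking the concatenation product of the results for the successive cycles, from left to right. For instance, $x_{(1\,3\,4)(2\,5)} = (1 \diamond (3 \diamond 4))(2 \diamond 5)$. **Theorem.** For every $A \subseteq [n]$ with $|A| \ge 2$, the family $(x_\tau)$, indexed by the permutations $\tau$ of $[n]$ with $\operatorname{supp}(\tau) = A$, is a basis of the real vector space $H_A$. In particular, $x_\tau \in H_A$ for each such $\tau$. -/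

import Mathlib

namespace RankingWavelets

/-- Injective words over an `n`-letter alphabet `Fin n` (with its usual order), the empty word
included. -/
abbrev InjWord (n : ℕ) : Type := {w : List (Fin n) // w.Nodup}

/-- The content of an injective word: the set of its letters. -/
def InjWord.content {n : ℕ} (w : InjWord n) : Finset (Fin n) := w.1.toFinset

/-- The space of chains: real linear combinations of injective words, that is, real functions on
the finite set of injective words. -/
abbrev Chain (n : ℕ) : Type := InjWord n →₀ ℝ

/-- Delete the letter `a` from a word (the word is unchanged if `a` does not occur in it). -/
def InjWord.delete {n : ℕ} (a : Fin n) (w : InjWord n) : InjWord n :=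
  ⟨w.1.erase a, w.2.erase a⟩

/-- The deletion operator `ϱ_a` on chains, the linear extension of the deletion of `a`. -/
noncomputable def deletion {n : ℕ} (a : Fin n) : Chain n →ₗ[ℝ] Chain n :=
  Finsupp.lmapDomain ℝ ℝ (InjWord.delete a)

/-- The concatenation of two words as a chain: the concatenated word if the contents are disjoint,
and `0` otherwise. -/
noncomputable def concatWord {n : ℕ} (u v : InjWord n) : Chain n :=
  if h : Disjoint u.content v.content then
    Finsupp.single ⟨u.1 ++ v.1, List.Nodup.append u.2 v.2 (List.disjoint_toFinset_iff_disjoint.1 h)⟩ 1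
  else 0

/-- The concatenation product of chains, the bilinear extension of `concatWord`. -/
noncomputable def concat {n : ℕ} (x y : Chain n) : Chain n :=
  x.sum fun u a => y.sum fun v b => (a * b) • concatWord u v

/-- The diamond operator `x ⋄ y = xy - yx`. -/
noncomputable def diamond {n : ℕ} (x y : Chain n) : Chain n :=
  concat x y - concat y x

/-- The space `H_A` of the chains on words of content `A` that are annihilated by the deletion
of every letter of `A`. -/
noncomputable def H {n : ℕ} (A : Finset (Fin n)) : Submodule ℝ (Chain n) :=
  Finsupp.supported ℝ ℝ {w : InjWord n | w.content = A} ⊓ ⨅ a ∈ A, LinearMap.ker (deletion a)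

/-- The standard cycle form of `τ`: the list of its cycles of length at least two, each one
written `[a, τ a, τ (τ a), …]` with its minimum `a` first, in increasing order of the minima. -/
def standardCycleForm {n : ℕ} (τ : Equiv.Perm (Fin n)) : List (List (Fin n)) :=
  ((List.finRange n).filter fun a => τ a ≠ a ∧ ∀ b, τ.SameCycle a b → a ≤ b).map τ.toList

/-- The quantities handled by the algorithm: single letters, and expressions `(Q ⋄ R)`. -/
inductive Quantity (n : ℕ) : Type
  | letter (a : Fin n) : Quantity n
  | dia (Q R : Quantity n) : Quantity n

/-- The leftmost letter of a quantity, which is the right-hand neighbor of a symbol `⋆` placed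
immediately before that quantity. -/
def Quantity.head {n : ℕ} : Quantity n → Fin n
  | .letter a => a
  | .dia Q _ => Q.head

/-- The chain obtained by expanding the diamond operations in a quantity. -/
noncomputable def Quantity.expand {n : ℕ} : Quantity n → Chain n
  | .letter a => Finsupp.single ⟨[a], List.nodup_singleton a⟩ 1
  | .dia Q R => diamond Q.expand R.expand

/-- A string of the algorithm is a list of pairs: a quantity, together with a Boolean that says
whether the symbol `⋆` stands immediately to the left of that quantity (otherwise the quantity is
the first one of its cycle). -/
abbrev StarString (n : ℕ) : Type := List (Bool × Quantity n)

/-- Insert `⋆` between consecutive letters of a cycle. -/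
def starCycle {n : ℕ} : List (Fin n) → StarString n
  | [] => []
  | a :: l => (false, .letter a) :: l.map fun b => (true, .letter b)

/-- Insert `⋆` between each consecutive pair of letters in each cycle of `τ`. -/
def initialString {n : ℕ} (τ : Equiv.Perm (Fin n)) : StarString n :=
  (standardCycleForm τ).flatMap starCycle

/-- The right-hand neighbors of the symbols `⋆` of a string. -/
def starNeighbors {n : ℕ} (s : StarString n) : List (Fin n) :=
  (s.filter fun q => q.1).map fun q => q.2.head

/-- Replace `Q ⋆ R` by `(Q ⋄ R)` at the symbol `⋆` whose right-hand neighbor is `b`. -/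
def mergeAt {n : ℕ} (b : Fin n) : StarString n → StarString n
  | [] => []
  | [p] => [p]
  | p :: q :: s =>
    if q.1 = true ∧ q.2.head = b then (p.1, .dia p.2 q.2) :: s
    else p :: mergeAt b (q :: s)

/-- One round of the algorithm: if there is no `⋆` in the string, leave it as it is; otherwise
perform the replacement at the symbol `⋆` with the largest right-hand neighbor. -/
def step {n : ℕ} (s : StarString n) : StarString n :=
  match (starNeighbors s).max? with
  | none => s
  | some b => mergeAt b s

/-- The string at which the algorithm halts. Each round removes one `⋆`, so that there are at most
as many rounds as entries of the initial string, and `step` fixes a string without `⋆`. -/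
def finalString {n : ℕ} (τ : Equiv.Perm (Fin n)) : StarString n :=
  step^[(initialString τ).length] (initialString τ)

/-- The output `x_τ` of the algorithm: the concatenation product of the quantities of the final
string, expanded. -/
noncomputable def xChain {n : ℕ} (τ : Equiv.Perm (Fin n)) : Chain n :=
  ((finalString τ).map fun q => q.2.expand).foldr concat (Finsupp.single ⟨[], List.nodup_nil⟩ 1)

end RankingWavelets

/-! Compare words lexicographically from right to left and call the smallest word of a chain its
leading word. Since the algorithm always treats the `⋆` with the largest right-hand neighbor, every
`(Q ⋄ R)` it forms has the leftmost letter of `Q` smaller than that of `R`. That letter is the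
minimum of its quantity, so words of `QR` end in something larger than the leading word of `RQ`
does. By induction a quantity leads with its letters reversed (`Quantity.Good.lead`).

Hence the leading word of `x_τ`, read from the right, lists the cycles of `τ` by decreasing minima,
each minimum first. This is Foata's fundamental correspondence: the cycles start at the
left-to-right minima. Distinct permutations thus have distinct leading words, and all `x_τ` together
are independent (`linearIndependent_xChain`).

Deletion is multiplicative on disjoint contents, and the empty word commutes with everything, so
deleting a letter kills each `⋄`-expression; thus `x_τ` lies in `H_A`.

For spanning, append to each `x_τ` with support inside `A` the remaining letters of `A`. Deleting a
fixed point separates these `|A|!` chains from one another (`coeff_eq_zero_of_deletion`), so they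
form a basis of the chains of content `A`. The same lemma shows that an element of `H_A` involves
only those with support exactly `A`. -/

namespace RankingWavelets

/-! ### Homogeneous chains and the concatenation product -/

variable {n : ℕ}

/-- The concatenation product as a bilinear map. -/
noncomputable def concatL : Chain n →ₗ[ℝ] Chain n →ₗ[ℝ] Chain n :=
  Finsupp.lsum ℝ fun u => LinearMap.toSpanSingleton ℝ _ (Finsupp.lsum ℝ fun v =>
    LinearMap.toSpanSingleton ℝ _ (concatWord u v))

theorem concat_eq_concatL (x y : Chain n) : concat x y = concatL x y := by
  simp only [concat, concatL, Finsupp.lsum_apply, LinearMap.toSpanSingleton_apply,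
    Finsupp.sum, LinearMap.sum_apply, LinearMap.smul_apply, Finset.smul_sum, mul_smul]

theorem concatL_single (u v : InjWord n) :
    concatL (Finsupp.single u 1) (Finsupp.single v 1) = concatWord u v := by
  simp [concatL]

/-- The chains on words of content `A`. -/
def homog (A : Finset (Fin n)) : Submodule ℝ (Chain n) :=
  Finsupp.supported ℝ ℝ {w : InjWord n | w.content = A}

theorem mem_homog {A : Finset (Fin n)} {x : Chain n} :
    x ∈ homog A ↔ ∀ w, x w ≠ 0 → w.content = A := by
  simp [homog, Finsupp.mem_supported, Set.subset_def]

theorem single_mem_homog {A : Finset (Fin n)} {w : InjWord n} (h : w.content = A) (r : ℝ) :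
    Finsupp.single w r ∈ homog A :=
  Finsupp.single_mem_supported _ _ h

theorem homog_induction {A : Finset (Fin n)} {p : Chain n → Prop} (zero : p 0)
    (add : ∀ x y, p x → p y → p (x + y)) (smul : ∀ (r : ℝ) x, p x → p (r • x))
    (single : ∀ w : InjWord n, w.content = A → p (Finsupp.single w 1))
    {x : Chain n} (hx : x ∈ homog A) : p x := by
  rw [homog, Finsupp.supported_eq_span_single] at hx
  induction hx using Submodule.span_induction with
  | mem x h => obtain ⟨w, hw, rfl⟩ := h; exact single w hw
  | zero => exact zero
  | add x y _ _ h1 h2 => exact add x y h1 h2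
  | smul r x _ h => exact smul r x h

theorem linear_ext_homog {M : Type*} [AddCommGroup M] [Module ℝ M] {A : Finset (Fin n)}
    {f g : Chain n →ₗ[ℝ] M}
    (h : ∀ u : InjWord n, u.content = A → f (Finsupp.single u 1) = g (Finsupp.single u 1))
    {x : Chain n} (hx : x ∈ homog A) : f x = g x := by
  exact homog_induction (p := fun x => f x = g x) (by simp) (fun x y h1 h2 => by simp [h1, h2])
    (fun r x h => by simp [h]) h hx

theorem bilinear_ext_homog {M : Type*} [AddCommGroup M] [Module ℝ M] {A B : Finset (Fin n)}
    {f g : Chain n →ₗ[ℝ] Chain n →ₗ[ℝ] M}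
    (h : ∀ u v : InjWord n, u.content = A → v.content = B →
      f (Finsupp.single u 1) (Finsupp.single v 1) = g (Finsupp.single u 1) (Finsupp.single v 1))
    {x y : Chain n} (hx : x ∈ homog A) (hy : y ∈ homog B) : f x y = g x y := by
  have : f.flip y = g.flip y → f x y = g x y := fun e => by
    simpa using congrArg (fun F => F x) e
  refine linear_ext_homog (f := f.flip y) (g := g.flip y) (fun u hu => ?_) hx
  exact linear_ext_homog (f := f (Finsupp.single u 1)) (g := g (Finsupp.single u 1))
    (fun v hv => h u v hu hv) hy

/-- The concatenation of two words with disjoint contents. -/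
def appendWord (u v : InjWord n) (h : Disjoint u.content v.content) : InjWord n :=
  ⟨u.1 ++ v.1, List.Nodup.append u.2 v.2 (List.disjoint_toFinset_iff_disjoint.1 h)⟩

theorem concatWord_of_disjoint {u v : InjWord n} (h : Disjoint u.content v.content) :
    concatWord u v = Finsupp.single (appendWord u v h) 1 := by
  simp [concatWord, h, appendWord]

theorem content_appendWord {u v : InjWord n} (h : Disjoint u.content v.content) :
    (appendWord u v h).content = u.content ∪ v.content := by
  simp [InjWord.content, appendWord]

theorem concat_mem_homog {A B : Finset (Fin n)} (hAB : Disjoint A B) {x y : Chain n}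
    (hx : x ∈ homog A) (hy : y ∈ homog B) : concat x y ∈ homog (A ∪ B) := by
  rw [concat_eq_concatL]
  refine homog_induction (p := fun x => concatL x y ∈ homog (A ∪ B)) (by simp)
    (fun x x' h1 h2 => by simpa using add_mem h1 h2)
    (fun r x h => by simpa using Submodule.smul_mem _ r h) (fun u hu => ?_) hx
  refine homog_induction (p := fun y => concatL (Finsupp.single u 1) y ∈ homog (A ∪ B)) (by simp)
    (fun x x' h1 h2 => by simpa using add_mem h1 h2)
    (fun r x h => by simpa using Submodule.smul_mem _ r h) (fun v hv => ?_) hy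
  subst hu hv
  rw [concatL_single, concatWord_of_disjoint hAB]
  exact single_mem_homog (content_appendWord hAB) 1

theorem exists_of_concat_ne_zero {x y : Chain n} {w : InjWord n} (h : concat x y w ≠ 0) :
    ∃ u v : InjWord n, x u ≠ 0 ∧ y v ≠ 0 ∧ w.1 = u.1 ++ v.1 := by
  simp only [concat, Finsupp.sum_apply] at h
  obtain ⟨u, hu, h⟩ := Finset.exists_ne_zero_of_sum_ne_zero h
  beta_reduce at h
  obtain ⟨v, hv, h⟩ := Finset.exists_ne_zero_of_sum_ne_zero h
  refine ⟨u, v, by simpa using hu, by simpa using hv, ?_⟩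
  by_cases hd : Disjoint u.content v.content
  · simp only [concatWord_of_disjoint hd, Finsupp.smul_apply, Finsupp.single_apply] at h
    split_ifs at h with he
    · rw [← he]
      rfl
    · simp at h
  · simp [concatWord, hd] at h

theorem card_content (w : InjWord n) : w.content.card = w.1.length :=
  List.toFinset_card_of_nodup w.2

/-- The contents fix the lengths of the factors, so a word splits in only one way and no
cancellation occurs. -/
theorem concat_apply_appendWord {x y : Chain n} {u v : InjWord n}
    (h : Disjoint u.content v.content) (hx : x ∈ homog u.content) (hy : y ∈ homog v.content) :
    concat x y (appendWord u v h) = x u * y v := by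
  have key : ∀ u' v' : InjWord n, u'.content = u.content → v'.content = v.content →
      concatWord u' v' (appendWord u v h) =
        (Finsupp.single u' 1 : Chain n) u * (Finsupp.single v' 1 : Chain n) v := by
    intro u' v' hu hv
    have hd : Disjoint u'.content v'.content := by rwa [hu, hv]
    rw [concatWord_of_disjoint hd]
    have hl : u'.1.length = u.1.length := by rw [← card_content, hu, card_content]
    have : appendWord u' v' hd = appendWord u v h ↔ u' = u ∧ v' = v := by
      simp only [appendWord, Subtype.ext_iff]
      exact ⟨fun e => List.append_inj e hl, fun e => by rw [e.1, e.2]⟩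
    simp only [Finsupp.single_apply, this]
    by_cases h1 : u' = u <;> by_cases h2 : v' = v <;> simp [h1, h2]
  rw [concat_eq_concatL]
  have := bilinear_ext_homog
    (f := (concatL (n := n)).compr₂ (Finsupp.lapply (appendWord u v h)))
    (g := (LinearMap.mul ℝ ℝ).compl₁₂ (Finsupp.lapply u) (Finsupp.lapply v))
    (fun u' v' hu hv => by simpa [concatL_single] using key u' v' hu hv) hx hy
  simpa using this

/-! ### Deletion -/

theorem deletion_single (a : Fin n) (w : InjWord n) :
    deletion a (Finsupp.single w 1) = Finsupp.single (w.delete a) 1 := by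
  simp [deletion]

theorem content_delete (a : Fin n) (w : InjWord n) :
    (w.delete a).content = w.content.erase a := by
  ext b
  simp [InjWord.content, InjWord.delete, w.2.mem_erase_iff]

theorem deletion_of_notMem {a : Fin n} {A : Finset (Fin n)} (ha : a ∉ A) {x : Chain n}
    (hx : x ∈ homog A) : deletion a x = x := by
  refine linear_ext_homog (f := deletion a) (g := LinearMap.id) (fun u hu => ?_) hx
  rw [deletion_single, LinearMap.id_apply]
  congr 1
  refine Subtype.ext (List.erase_of_not_mem ?_)
  rw [← hu] at ha
  simpa [InjWord.content] using ha

/-- Disjointness is essential: for `x = y = a` the product is `0`, but after deletion it is the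
empty word. -/
theorem deletion_concat {A B : Finset (Fin n)} (hAB : Disjoint A B) (a : Fin n) {x y : Chain n}
    (hx : x ∈ homog A) (hy : y ∈ homog B) :
    deletion a (concat x y) = concat (deletion a x) (deletion a y) := by
  rw [concat_eq_concatL, concat_eq_concatL]
  have := bilinear_ext_homog
    (f := (concatL (n := n)).compr₂ (deletion a))
    (g := (concatL (n := n)).compl₁₂ (deletion a) (deletion a)) (fun u v hu hv => ?_) hx hy
  · simpa using this
  subst hu hv
  have hd : Disjoint (u.delete a).content (v.delete a).content := by
    rw [content_delete, content_delete]
    exact hAB.mono (Finset.erase_subset _ _) (Finset.erase_subset _ _)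
  simp only [LinearMap.compr₂_apply, LinearMap.compl₁₂_apply, deletion_single, concatL_single]
  rw [concatWord_of_disjoint hAB, concatWord_of_disjoint hd, deletion_single]
  congr 1
  apply Subtype.ext
  simp only [InjWord.delete, appendWord, List.erase_append]
  split_ifs with h
  · rw [List.erase_of_not_mem (l := v.1)]
    exact fun h' => Finset.disjoint_left.1 hAB (List.mem_toFinset.2 h) (List.mem_toFinset.2 h')
  · rw [List.erase_of_not_mem h]

/-- The empty word as a chain. -/
noncomputable def unit : Chain n := Finsupp.single ⟨[], List.nodup_nil⟩ 1

theorem unit_concat (x : Chain n) : concat unit x = x := by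
  rw [concat_eq_concatL]
  suffices concatL (unit : Chain n) = LinearMap.id by rw [this]; rfl
  ext1 v
  ext1
  simp only [LinearMap.comp_apply, Finsupp.lsingle_apply, unit, concatL_single, LinearMap.id_apply]
  rw [concatWord_of_disjoint (by simp [InjWord.content])]
  rfl

theorem concat_unit (x : Chain n) : concat x unit = x := by
  rw [concat_eq_concatL]
  suffices (concatL (n := n)).flip unit = LinearMap.id by
    simpa using congrArg (fun F => F x) this
  ext1 v
  ext1
  simp only [LinearMap.comp_apply, Finsupp.lsingle_apply, unit, LinearMap.flip_apply,
    concatL_single, LinearMap.id_apply]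
  rw [concatWord_of_disjoint (by simp [InjWord.content])]
  simp [appendWord]

theorem zero_concat (x : Chain n) : concat 0 x = 0 := by simp [concat_eq_concatL]
theorem concat_zero (x : Chain n) : concat x 0 = 0 := by simp [concat_eq_concatL]

/-! ### Leading words -/

/-- The word `l` is the leading word of the chain `x`: words are compared lexicographically, read
from right to left, and the leading word is the smallest one. -/
structure Lead (l : List (Fin n)) (x : Chain n) : Prop where
  ne_zero : ∃ h : l.Nodup, x ⟨l, h⟩ ≠ 0
  content_eq : ∀ w : InjWord n, x w ≠ 0 → w.content = l.toFinset
  le : ∀ w : InjWord n, x w ≠ 0 → l.reverse ≤ w.1.reverse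

theorem Lead.mem_homog {l : List (Fin n)} {x : Chain n} (h : Lead l x) : x ∈ homog l.toFinset :=
  RankingWavelets.mem_homog.2 h.content_eq

theorem cons_le_cons_iff_of_linearOrder {α : Type*} [LinearOrder α] {a b : α} {s t : List α} :
    a :: s ≤ b :: t ↔ a < b ∨ a = b ∧ s ≤ t := by
  rw [le_iff_lt_or_eq, le_iff_lt_or_eq, List.cons_lt_cons_iff, List.cons.injEq]
  tauto

theorem append_le_append {α : Type*} [LinearOrder α] {u u' v v' : List α}
    (hl : u.length = u'.length) (h : u ≤ u') (h' : v ≤ v') : u ++ v ≤ u' ++ v' := by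
  induction u generalizing u' with
  | nil => cases u' with
    | nil => simpa
    | cons => simp at hl
  | cons a t ih => cases u' with
    | nil => simp at hl
    | cons b s =>
      rw [cons_le_cons_iff_of_linearOrder] at h
      simp only [List.cons_append, cons_le_cons_iff_of_linearOrder]
      rcases h with h | ⟨rfl, h⟩
      · exact Or.inl h
      · exact Or.inr ⟨rfl, ih (by simpa using hl) h⟩

/-- Read from the right, the second factor is compared first. By homogeneity all its words have the
same length, so the comparison proceeds factor by factor. -/
theorem Lead.concat {l m : List (Fin n)} {x y : Chain n} (hx : Lead l x) (hy : Lead m y)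
    (hd : l.Disjoint m) : Lead (l ++ m) (concat x y) := by
  have hd' : Disjoint l.toFinset m.toFinset := List.disjoint_toFinset_iff_disjoint.2 hd
  obtain ⟨hl, hxl⟩ := hx.ne_zero
  obtain ⟨hm, hym⟩ := hy.ne_zero
  refine ⟨⟨List.Nodup.append hl hm hd, ?_⟩, fun w hw => ?_, fun w hw => ?_⟩
  · have := concat_apply_appendWord (u := ⟨l, hl⟩) (v := ⟨m, hm⟩) hd' hx.mem_homog hy.mem_homog
    simp only [appendWord] at this
    rw [this]
    exact mul_ne_zero hxl hym
  · rw [List.toFinset_append]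
    exact RankingWavelets.mem_homog.1 (concat_mem_homog hd' hx.mem_homog hy.mem_homog) w hw
  · obtain ⟨u, v, hu, hv, h⟩ := exists_of_concat_ne_zero hw
    rw [h, List.reverse_append, List.reverse_append]
    refine append_le_append ?_ (hy.le v hv) (hx.le u hu)
    rw [List.length_reverse, List.length_reverse, ← card_content, hy.content_eq v hv,
      List.toFinset_card_of_nodup hm]

theorem lead_unit : Lead [] (unit : Chain n) := by
  have : ∀ w : InjWord n, (unit : Chain n) w ≠ 0 → w.1 = [] := fun w hw => by
    simp only [unit, Finsupp.single_apply] at hw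
    split_ifs at hw with h
    · rw [← h]
    · simp at hw
  refine ⟨⟨List.nodup_nil, by simp [unit]⟩, fun w hw => ?_, fun w hw => ?_⟩
  · simp [InjWord.content, this w hw]
  · simp [this w hw]

/-- In a linear relation, the smallest leading word among the chains with nonzero coefficient occurs
in only one of them. -/
theorem linearIndependent_of_lead {ι : Type*} {x : ι → Chain n} {l : ι → List (Fin n)}
    (hl : Function.Injective l) (h : ∀ i, Lead (l i) (x i)) : LinearIndependent ℝ x := by
  classical
  rw [linearIndependent_iff']
  intro s g hg
  by_contra! hne
  obtain ⟨i₀, hi₀, hne⟩ := hne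
  obtain ⟨i, hi, hmin⟩ := Finset.exists_min_image (s.filter fun i => g i ≠ 0)
    (fun i => (l i).reverse) ⟨i₀, by simp [hi₀, hne]⟩
  rw [Finset.mem_filter] at hi
  obtain ⟨hn, hxi⟩ := (h i).ne_zero
  have e := congrArg (fun F : Chain n => F ⟨l i, hn⟩) hg
  simp only [Finsupp.finsetSum_apply, Finsupp.smul_apply, smul_eq_mul, Finsupp.zero_apply] at e
  rw [Finset.sum_eq_single_of_mem i hi.1] at e
  · exact (mul_ne_zero hi.2 hxi) e
  · intro j hj hji
    by_contra hc
    have h1 := hmin j (Finset.mem_filter.2 ⟨hj, left_ne_zero_of_mul hc⟩)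
    have h2 := (h j).le _ (right_ne_zero_of_mul hc)
    exact hji (hl (List.reverse_injective (le_antisymm h2 h1)))

/-! ### Quantities -/

namespace Quantity

/-- The letters of a quantity, from left to right. -/
def word : Quantity n → List (Fin n)
  | .letter a => [a]
  | .dia Q R => Q.word ++ R.word

/-- The letters of the quantity are distinct, and in each subexpression `(Q ⋄ R)` the leftmost
letter of `Q` is smaller than the one of `R`. -/
def Good : Quantity n → Prop
  | .letter _ => True
  | .dia Q R => Q.Good ∧ R.Good ∧ Q.word.Disjoint R.word ∧ Q.head < R.head

theorem word_eq_cons (Q : Quantity n) : Q.word = Q.head :: Q.word.tail := by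
  induction Q with
  | letter a => rfl
  | dia Q R hQ hR =>
    rw [word, head, hQ]
    simp

theorem Good.head_le {Q : Quantity n} (h : Q.Good) {b : Fin n} (hb : b ∈ Q.word) :
    Q.head ≤ b := by
  induction Q with
  | letter a => simp_all [word, head]
  | dia Q R hQ hR =>
    rcases List.mem_append.1 hb with hb | hb
    · exact hQ h.1 hb
    · exact h.2.2.2.le.trans (hR h.2.1 hb)

theorem Good.lead {Q : Quantity n} (h : Q.Good) : Lead Q.word.reverse Q.expand := by
  induction Q with
  | letter a =>
    have : ∀ w : InjWord n, (letter a).expand w ≠ 0 → w.1 = [a] := fun w hw => by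
      simp only [expand, Finsupp.single_apply] at hw
      split_ifs at hw with h
      · rw [← h]
      · simp at hw
    refine ⟨⟨by simp [word], by simp [expand, word]⟩, fun w hw => ?_, fun w hw => ?_⟩
    · simp [InjWord.content, this w hw, word]
    · simp [this w hw, word]
  | dia Q R hQ hR =>
    obtain ⟨gQ, gR, hd, hlt⟩ := h
    have lQ := hQ gQ
    have lR := hR gR
    have l1 := lQ.concat lR (by simpa [List.Disjoint] using hd)
    have l2 := lR.concat lQ (by simpa [List.Disjoint] using hd.symm)
    have small : ∀ w : InjWord n, concat Q.expand R.expand w ≠ 0 →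
        (dia Q R).word.reverse.reverse < w.1.reverse := by
      intro w hw
      obtain ⟨u, v, hu, hv, e⟩ := exists_of_concat_ne_zero hw
      rw [e, List.reverse_append, List.reverse_reverse, word, word_eq_cons Q]
      have hc := lR.content_eq v hv
      rcases hv' : v.1.reverse with _ | ⟨b, t⟩
      · rw [word_eq_cons R, InjWord.content] at hc
        rw [List.reverse_eq_nil_iff.1 hv'] at hc
        exact absurd hc.symm (by simp)
      -- The first letter from the right belongs to `R`, hence is at least `R.head`, which exceeds
      -- `Q.head`.
      · rw [List.cons_append, List.cons_append, List.cons_lt_cons_iff]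
        left
        refine hlt.trans_le (gR.head_le ?_)
        have hb : b ∈ v.1.reverse := by simp [hv']
        rw [List.mem_reverse, ← List.mem_toFinset] at hb
        rw [InjWord.content] at hc
        simpa [hc] using hb
    have split : ∀ w : InjWord n, (dia Q R).expand w ≠ 0 →
        concat Q.expand R.expand w ≠ 0 ∨ concat R.expand Q.expand w ≠ 0 := by
      intro w hw
      by_contra! hc
      simp [expand, diamond, hc] at hw
    have ew : (dia Q R).word.reverse = R.word.reverse ++ Q.word.reverse := by simp [word]
    refine ⟨?_, fun w hw => ?_, fun w hw => ?_⟩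
    · rw [ew]
      obtain ⟨hn, hne⟩ := l2.ne_zero
      refine ⟨hn, ?_⟩
      -- All words of `QR` are strictly larger, so the leading term of `RQ` is not cancelled.
      have h0 : concat Q.expand R.expand ⟨_, hn⟩ = 0 := by
        by_contra hc
        exact lt_irrefl _ (ew ▸ small _ hc)
      simpa [expand, diamond, h0] using hne
    · rw [ew]
      rcases split w hw with h | h
      · rw [l1.content_eq w h]
        simp [Finset.union_comm]
      · exact l2.content_eq w h
    · rcases split w hw with h | h
      · exact (small w h).le
      · rw [ew]
        exact l2.le w h

theorem Good.mem_homog {Q : Quantity n} (h : Q.Good) : Q.expand ∈ homog Q.word.toFinset := by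
  simpa using h.lead.mem_homog

/-- Deletion turns the factor containing `a` into the empty word or `0`, and both commute with the
other factor. The single-letter case is stated because the induction passes through it. -/
theorem Good.deletion_expand {Q : Quantity n} (h : Q.Good) {a : Fin n} (ha : a ∈ Q.word) :
    deletion a Q.expand = if Q.word.length = 1 then unit else 0 := by
  induction Q with
  | letter b =>
    obtain rfl : a = b := by simpa [word] using ha
    rw [expand, deletion_single]
    simp [word, unit, InjWord.delete]
  | dia Q R hQ hR =>
    obtain ⟨gQ, gR, hd, -⟩ := h
    have hd' : Disjoint Q.word.toFinset R.word.toFinset :=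
      List.disjoint_toFinset_iff_disjoint.2 hd
    have hlen : ¬ (dia Q R).word.length = 1 := by
      rw [word, word_eq_cons Q, word_eq_cons R]
      simp
    rw [if_neg hlen, expand, diamond, map_sub, deletion_concat hd' a gQ.mem_homog gR.mem_homog,
      deletion_concat hd'.symm a gR.mem_homog gQ.mem_homog]
    rcases List.mem_append.1 ha with ha | ha
    · rw [hQ gQ ha, deletion_of_notMem (fun h => hd ha (List.mem_toFinset.1 h)) gR.mem_homog]
      split_ifs
      · simp [unit_concat, concat_unit]
      · simp [zero_concat, concat_zero]
    · rw [hR gR ha, deletion_of_notMem (fun h => hd (List.mem_toFinset.1 h) ha) gQ.mem_homog]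
      split_ifs
      · simp [unit_concat, concat_unit]
      · simp [zero_concat, concat_zero]

end Quantity

/-- The concatenation product of a list of quantities. -/
noncomputable def prodExpand (L : List (Quantity n)) : Chain n :=
  (L.map Quantity.expand).foldr concat unit

theorem lead_prodExpand {L : List (Quantity n)} (hg : ∀ Q ∈ L, Q.Good)
    (hn : (L.flatMap Quantity.word).Nodup) :
    Lead (L.flatMap fun Q => Q.word.reverse) (prodExpand L) := by
  induction L with
  | nil => exact lead_unit
  | cons Q L ih =>
    rw [List.flatMap_cons, List.nodup_append'] at hn
    refine ((hg Q (by simp)).lead).concat (ih (fun R hR => hg R (by simp [hR])) hn.2.1) ?_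
    simpa [List.Disjoint] using hn.2.2

theorem deletion_prodExpand {L : List (Quantity n)} (hg : ∀ Q ∈ L, Q.Good)
    (hn : (L.flatMap Quantity.word).Nodup) (hl : ∀ Q ∈ L, Q.word.length ≠ 1) {a : Fin n}
    (ha : a ∈ L.flatMap Quantity.word) : deletion a (prodExpand L) = 0 := by
  induction L with
  | nil => simp at ha
  | cons Q L ih =>
    rw [List.flatMap_cons, List.nodup_append'] at hn
    have gL : ∀ R ∈ L, R.Good := fun R hR => hg R (by simp [hR])
    have hd : Disjoint Q.word.toFinset (L.flatMap fun Q => Q.word.reverse).toFinset := by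
      rw [List.disjoint_toFinset_iff_disjoint]
      simpa [List.Disjoint] using hn.2.2
    have : prodExpand (Q :: L) = concat Q.expand (prodExpand L) := rfl
    rw [this, deletion_concat hd a (hg Q (by simp)).mem_homog (lead_prodExpand gL hn.2.1).mem_homog]
    rw [List.flatMap_cons, List.mem_append] at ha
    rcases ha with ha | ha
    · rw [(hg Q (by simp)).deletion_expand ha, if_neg (hl Q (by simp)), zero_concat]
    · rw [ih gL hn.2.1 (fun R hR => hl R (by simp [hR])) ha, concat_zero]

/-! ### The algorithm -/

/-- The letters of a string, each with a Boolean that says whether it has a predecessor in its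
cycle. -/
def tagged (s : StarString n) : List (Bool × Fin n) :=
  s.flatMap fun p => (p.1, p.2.head) :: p.2.word.tail.map fun b => (true, b)

/-- Every letter without predecessor is smaller than the letters of its cycle that follow it. -/
def CycleMin : List (Bool × Fin n) → Prop
  | [] => True
  | p :: t => (p.1 = false → ∀ q ∈ t.takeWhile (·.1), p.2 < q.2) ∧ CycleMin t

theorem tagged_cons (p : Bool × Quantity n) (s : StarString n) :
    tagged (p :: s) = (p.1, p.2.head) :: ((p.2.word.tail.map fun b => (true, b)) ++ tagged s) := by
  simp [tagged]

theorem tagged_dia (p q : Bool × Quantity n) (hq : q.1 = true) (s : StarString n) :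
    tagged ((p.1, .dia p.2 q.2) :: s) = tagged (p :: q :: s) := by
  have h : (Quantity.dia p.2 q.2).word.tail = p.2.word.tail ++ q.2.head :: q.2.word.tail := by
    rw [Quantity.word, ← Quantity.word_eq_cons q.2, p.2.word_eq_cons]
    rfl
  simp [tagged_cons, h, hq, Quantity.head]

/-- Merging moves no letter and stays within a cycle, so the tagged letters are an invariant of the
algorithm. -/
theorem tagged_mergeAt (b : Fin n) (s : StarString n) : tagged (mergeAt b s) = tagged s := by
  induction s with
  | nil => rfl
  | cons p s ih =>
    cases s with
    | nil => rfl
    | cons q s =>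
      rw [mergeAt]
      split_ifs with h
      · exact tagged_dia p q h.1 s
      · rw [tagged_cons, ih, ← tagged_cons]

theorem tagged_map_snd (s : StarString n) :
    (tagged s).map Prod.snd = s.flatMap fun p => p.2.word := by
  induction s with
  | nil => rfl
  | cons p s ih =>
    rw [tagged_cons, List.flatMap_cons, Quantity.word_eq_cons p.2]
    simp [ih, Function.comp_def]

theorem CycleMin.of_append {u v : List (Bool × Fin n)} (h : CycleMin (u ++ v)) : CycleMin v := by
  induction u with
  | nil => exact h
  | cons p u ih => exact ih h.2

theorem CycleMin.tail {p : Bool × Quantity n} {s : StarString n} (h : CycleMin (tagged (p :: s))) :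
    CycleMin (tagged s) := by
  rw [tagged_cons] at h
  exact h.2.of_append

/-- This is where the choice of the largest neighbor matters. When `Q ⋆ R` is merged, either `Q`
opens its cycle and its head is the cycle minimum, or a `⋆` precedes `Q` and its head is at most
`b`, hence smaller since letters are distinct. -/
theorem good_mergeAt {b : Fin n} {s : StarString n} (hg : ∀ p ∈ s, p.2.Good)
    (hn : (s.flatMap fun p => p.2.word).Nodup) (hm : CycleMin (tagged s))
    (hb : ∀ c ∈ starNeighbors s, c ≤ b) : ∀ p ∈ mergeAt b s, p.2.Good := by
  induction s with
  | nil => simp [mergeAt]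
  | cons p s ih =>
    cases s with
    | nil => exact hg
    | cons q s =>
      rw [List.flatMap_cons, List.nodup_append'] at hn
      rw [mergeAt]
      split_ifs with h
      · have hd : p.2.word.Disjoint q.2.word := by
          have := hn.2.2
          rw [List.flatMap_cons, List.disjoint_append_right] at this
          exact this.1
        intro r hr
        rcases List.mem_cons.1 hr with rfl | hr
        · refine ⟨hg p (by simp), hg q (by simp), hd, ?_⟩
          cases hp : p.1 with
          | false =>
            rw [tagged_cons, tagged_cons] at hm
            refine hm.1 hp (true, q.2.head) ?_
            -- The other letters of `p` are tagged `true`, so `takeWhile` runs past them and reaches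
            -- the head of `q`.
            rw [h.1, List.takeWhile_append_of_pos fun a ha => by
              obtain ⟨c, -, rfl⟩ := List.mem_map.1 ha
              rfl]
            simp
          | true =>
            rw [h.2]
            refine lt_of_le_of_ne (hb _ ?_) ?_
            · simp [starNeighbors, hp]
            · intro e
              refine hd (a := p.2.head) ?_ ?_
              · rw [Quantity.word_eq_cons p.2]; simp
              · rw [Quantity.word_eq_cons q.2, h.2, e]; simp
        · exact hg r (by simp [hr])
      · intro r hr
        rcases List.mem_cons.1 hr with rfl | hr
        · exact hg _ (by simp)
        · refine ih (fun r hr => hg r (List.mem_cons_of_mem _ hr)) hn.2.1 hm.tail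
            (fun c hc => hb c ?_) r hr
          simp only [starNeighbors, List.mem_map, List.mem_filter] at hc ⊢
          obtain ⟨q, hq, rfl⟩ := hc
          exact ⟨q, ⟨List.mem_cons_of_mem _ hq.1, hq.2⟩, rfl⟩

theorem starNeighbors_cons (p : Bool × Quantity n) (s : StarString n) :
    starNeighbors (p :: s) = if p.1 = true then p.2.head :: starNeighbors s
      else starNeighbors s := by
  simp only [starNeighbors, List.filter_cons]
  split_ifs <;> simp

theorem length_starNeighbors_mergeAt {b : Fin n} {p : Bool × Quantity n} {s : StarString n}
    (hb : b ∈ starNeighbors s) :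
    (starNeighbors (mergeAt b (p :: s))).length + 1 = (starNeighbors (p :: s)).length := by
  induction s generalizing p with
  | nil => simp [starNeighbors] at hb
  | cons q s ih =>
    rw [mergeAt]
    split_ifs with h
    · simp only [starNeighbors_cons, h.1]
      split_ifs <;> simp
    · rw [starNeighbors_cons] at hb
      have hb' : b ∈ starNeighbors s := by
        split_ifs at hb with hq
        · rcases List.mem_cons.1 hb with e | e
          · exact absurd ⟨hq, e.symm⟩ h
          · exact e
        · exact hb
      have := ih (p := q) hb'
      rw [starNeighbors_cons p, starNeighbors_cons p]
      split_ifs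
      · simp only [List.length_cons]
        omega
      · exact this

/-- The invariants of the algorithm, run on a string whose letters form the list `T`. -/
structure Inv (T : List (Bool × Fin n)) (s : StarString n) : Prop where
  good : ∀ p ∈ s, p.2.Good
  tagged_eq : tagged s = T

theorem Inv.step {T : List (Bool × Fin n)} (hn : (T.map Prod.snd).Nodup) (hm : CycleMin T)
    {s : StarString n} (h : Inv T s) : Inv T (step s) := by
  rw [RankingWavelets.step]
  split
  · exact h
  · rename_i b hb
    rw [List.max?_eq_some_iff] at hb
    refine ⟨good_mergeAt h.good ?_ (h.tagged_eq ▸ hm) hb.2, by rw [tagged_mergeAt, h.tagged_eq]⟩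
    rwa [← tagged_map_snd, h.tagged_eq]

/-- `hT` ensures that every `⋆` has a quantity to its left, so that `mergeAt` does find the chosen
one. -/
theorem length_starNeighbors_step {T : List (Bool × Fin n)} (hT : ∀ p ∈ T.head?, p.1 = false)
    {s : StarString n} (h : Inv T s) :
    (starNeighbors (RankingWavelets.step s)).length = (starNeighbors s).length - 1 := by
  rw [RankingWavelets.step]
  split
  · rename_i hb
    rw [List.max?_eq_none_iff] at hb
    simp [hb]
  · rename_i b hb
    rw [List.max?_eq_some_iff] at hb
    cases s with
    | nil => simp [starNeighbors] at hb
    | cons p s =>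
      have hp : p.1 = false := by
        rw [← h.tagged_eq, tagged_cons] at hT
        exact hT (p.1, p.2.head) (by simp)
      have := hb.1
      rw [starNeighbors_cons, hp] at this
      rw [← length_starNeighbors_mergeAt (p := p) (by simpa using this)]
      rfl

theorem Inv.iterate {T : List (Bool × Fin n)} (hn : (T.map Prod.snd).Nodup) (hm : CycleMin T)
    (hT : ∀ p ∈ T.head?, p.1 = false) {s : StarString n} (h : Inv T s) (k : ℕ) :
    Inv T (RankingWavelets.step^[k] s) ∧
      (starNeighbors (RankingWavelets.step^[k] s)).length = (starNeighbors s).length - k := by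
  induction k with
  | zero => exact ⟨h, rfl⟩
  | succ k ih =>
    rw [Function.iterate_succ_apply']
    refine ⟨ih.1.step hn hm, ?_⟩
    rw [length_starNeighbors_step hT ih.1, ih.2]
    omega

/-- A list of nonempty lists that can be recovered from its flattening: the first letter `a` of
each list is related by `R` to the other letters of that list, but not to the first letter of the
next one. -/
inductive Blocks {β : Type*} (R : β → β → Prop) : List (List β) → Prop
  | nil : Blocks R []
  | cons (a : β) (t : List β) (cs : List (List β)) (ht : ∀ b ∈ t, R a b)
      (hcs : ∀ b ∈ cs.flatten.head?, ¬ R a b) (h : Blocks R cs) : Blocks R ((a :: t) :: cs)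

/-- The first block is its first letter followed by the longest run of letters related to it. This
serves twice: with the tags, to read off the cycles from the final string, and with `<`, to invert
Foata's correspondence. -/
theorem Blocks.eq_of_flatten_eq {β : Type*} {R : β → β → Prop} {cs ds : List (List β)}
    (hc : Blocks R cs) (hd : Blocks R ds) (h : cs.flatten = ds.flatten) : cs = ds := by
  classical
  induction hc generalizing ds with
  | nil =>
    cases hd with
    | nil => rfl
    | cons => simp at h
  | cons a t cs ht hcs _ ih =>
    cases hd with
    | nil => simp at h
    | cons b u ds hu hds hd =>
      rw [List.flatten_cons, List.flatten_cons, List.cons_append, List.cons_append,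
        List.cons.injEq] at h
      obtain ⟨rfl, h⟩ := h
      have key : ∀ (t X : List β), (∀ b ∈ t, R a b) → (∀ b ∈ X.head?, ¬ R a b) →
          (t ++ X).takeWhile (fun b => R a b) = t := by
        intro t X h1 h2
        rw [List.takeWhile_append_of_pos (by simpa using h1)]
        cases X with
        | nil => simp
        | cons x X => simp [h2 x (by simp)]
      have e : t = u := by rw [← key t _ ht hcs, h, key u _ hu hds]
      subst e
      rw [ih hd (List.append_cancel_left h)]

/-- The letters of a cycle, with Booleans as in `tagged`. -/
def tagCycle : List (Fin n) → List (Bool × Fin n)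
  | [] => []
  | a :: l => (false, a) :: l.map fun b => (true, b)

theorem tagCycle_injective : Function.Injective (tagCycle (n := n)) := by
  intro c d h
  have key : ∀ c : List (Fin n), (tagCycle c).map Prod.snd = c := by
    intro c
    cases c <;> simp [tagCycle, Function.comp_def]
  rw [← key c, h, key d]

theorem blocks_tagCycle {cs : List (List (Fin n))} (h : ∀ c ∈ cs, c ≠ []) :
    Blocks (fun _ q => q.1 = true) (cs.map tagCycle) := by
  induction cs with
  | nil => exact .nil
  | cons c cs ih =>
    cases c with
    | nil => simp at h
    | cons a t =>
      refine .cons _ _ _ (by simp) ?_ (ih fun c hc => h c (by simp [hc]))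
      cases cs with
      | nil => simp
      | cons d cs =>
        cases d with
        | nil => simp at h
        | cons b u => simp [tagCycle]

theorem eq_of_flatMap_tagCycle_eq {cs ds : List (List (Fin n))} (hc : ∀ c ∈ cs, c ≠ [])
    (hd : ∀ c ∈ ds, c ≠ []) (h : cs.flatMap tagCycle = ds.flatMap tagCycle) : cs = ds :=
  List.map_injective_iff.2 tagCycle_injective <|
    (blocks_tagCycle hc).eq_of_flatten_eq (blocks_tagCycle hd) <| by
      simpa [List.flatMap_def] using h

theorem cycleMin_flatMap_tagCycle {cs : List (List (Fin n))}
    (h : ∀ c ∈ cs, ∃ a t, c = a :: t ∧ ∀ b ∈ t, a < b) : CycleMin (cs.flatMap tagCycle) := by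
  induction cs with
  | nil => trivial
  | cons c cs ih =>
    have ih := ih fun c hc => h c (by simp [hc])
    obtain ⟨a, t, rfl, ht⟩ := h c (by simp)
    have e : (cs.flatMap tagCycle).takeWhile (·.1) = [] := by
      cases cs with
      | nil => rfl
      | cons d cs =>
        obtain ⟨b, u, rfl, -⟩ := h d (by simp)
        simp [tagCycle]
    have aux : ∀ t : List (Fin n),
        CycleMin ((t.map fun b => (true, b)) ++ cs.flatMap tagCycle) := by
      intro t
      induction t with
      | nil => exact ih
      | cons b t iht => exact ⟨by simp, iht⟩
    rw [List.flatMap_cons, tagCycle, List.cons_append]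
    refine ⟨fun _ => ?_, aux t⟩
    rw [List.takeWhile_append_of_pos (by simp), e]
    simpa using ht

theorem tagged_starCycle (c : List (Fin n)) : tagged (starCycle c) = tagCycle c := by
  cases c with
  | nil => rfl
  | cons a t =>
    simp [starCycle, tagged, tagCycle, Quantity.word, Quantity.head, List.flatMap_map,
      ← List.map_eq_flatMap]

theorem tagged_flatMap_starCycle (cs : List (List (Fin n))) :
    tagged (cs.flatMap starCycle) = cs.flatMap tagCycle := by
  induction cs with
  | nil => rfl
  | cons c cs ih =>
    rw [List.flatMap_cons, List.flatMap_cons, ← ih, ← tagged_starCycle]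
    simp [tagged]

theorem tagged_of_starNeighbors_eq_nil {s : StarString n} (h : starNeighbors s = []) :
    tagged s = (s.map fun p => p.2.word).flatMap tagCycle := by
  induction s with
  | nil => rfl
  | cons p s ih =>
    rw [starNeighbors_cons] at h
    split_ifs at h with hp
    rw [tagged_cons, ih h, List.map_cons, List.flatMap_cons, p.2.word_eq_cons]
    simp [tagCycle, hp]

/-- The algorithm, run on a list of cycles with minimum first, ends with good quantities whose
letters are those of the cycles. -/
theorem run_starCycle {cs : List (List (Fin n))}
    (h : ∀ c ∈ cs, ∃ a t, c = a :: t ∧ ∀ b ∈ t, a < b) (hn : cs.flatten.Nodup) {k : ℕ}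
    (hk : (cs.flatMap starCycle).length ≤ k) :
    (∀ p ∈ step^[k] (cs.flatMap starCycle), p.2.Good) ∧
      (step^[k] (cs.flatMap starCycle)).map (fun p => p.2.word) = cs := by
  have e := tagged_flatMap_starCycle cs
  have hg : ∀ p ∈ cs.flatMap starCycle, p.2.Good := by
    intro p hp
    obtain ⟨c, -, hp⟩ := List.mem_flatMap.1 hp
    cases c with
    | nil => simp [starCycle] at hp
    | cons a t =>
      rcases List.mem_cons.1 hp with rfl | hp
      · trivial
      · obtain ⟨b, -, rfl⟩ := List.mem_map.1 hp
        trivial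
  have hn' : ((cs.flatMap tagCycle).map Prod.snd).Nodup := by
    have : (cs.flatMap tagCycle).map Prod.snd = cs.flatten := by
      rw [List.map_flatMap, List.flatten_eq_flatMap]
      refine List.flatMap_congr fun c _ => ?_
      cases c <;> simp [tagCycle, Function.comp_def]
    rwa [this]
  have hT : ∀ p ∈ (cs.flatMap tagCycle).head?, p.1 = false := by
    cases cs with
    | nil => simp
    | cons c cs =>
      obtain ⟨a, t, rfl, -⟩ := h c (by simp)
      simp [tagCycle]
  obtain ⟨h1, h2⟩ := (Inv.mk hg e).iterate hn' (cycleMin_flatMap_tagCycle h) hT k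
  refine ⟨h1.good, eq_of_flatMap_tagCycle_eq ?_ ?_ ?_⟩
  · intro c hc
    obtain ⟨p, -, rfl⟩ := List.mem_map.1 hc
    rw [p.2.word_eq_cons]
    simp
  · intro c hc
    obtain ⟨a, t, rfl, -⟩ := h c hc
    simp
  · rw [← tagged_of_starNeighbors_eq_nil, h1.tagged_eq]
    rw [← List.length_eq_zero_iff, h2]
    -- Each round removes one `⋆`, and there are at most as many of them as entries, hence at most
    -- `k`.
    have : (starNeighbors (cs.flatMap starCycle)).length ≤ (cs.flatMap starCycle).length := by
      rw [starNeighbors, List.length_map]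
      exact List.length_filter_le _ _
    omega

/-! ### The standard cycle form -/

/-- The minima of the nontrivial cycles of `τ`, in increasing order. -/
def cycleMinima (τ : Equiv.Perm (Fin n)) : List (Fin n) :=
  (List.finRange n).filter fun a => τ a ≠ a ∧ ∀ b, τ.SameCycle a b → a ≤ b

theorem standardCycleForm_eq (τ : Equiv.Perm (Fin n)) :
    standardCycleForm τ = (cycleMinima τ).map τ.toList := rfl

theorem mem_cycleMinima {τ : Equiv.Perm (Fin n)} {a : Fin n} :
    a ∈ cycleMinima τ ↔ τ a ≠ a ∧ ∀ b, τ.SameCycle a b → a ≤ b := by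
  simp [cycleMinima]

theorem pairwise_cycleMinima (τ : Equiv.Perm (Fin n)) : (cycleMinima τ).Pairwise (· < ·) :=
  (List.pairwise_lt_finRange n).filter _

theorem toList_of_mem_cycleMinima {τ : Equiv.Perm (Fin n)} {a : Fin n}
    (ha : a ∈ cycleMinima τ) : ∃ t, τ.toList a = a :: t ∧ ∀ b ∈ t, a < b := by
  rw [mem_cycleMinima] at ha
  have hs : a ∈ τ.support := Equiv.Perm.mem_support.2 ha.1
  have h0 := τ.toList_getElem_zero a hs
  rcases h : τ.toList a with _ | ⟨b, t⟩
  · exact absurd hs (Equiv.Perm.toList_eq_nil_iff.1 h)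
  · simp only [h, List.getElem_cons_zero] at h0
    subst h0
    have hn := τ.nodup_toList b
    rw [h, List.nodup_cons] at hn
    refine ⟨t, rfl, fun c hc => lt_of_le_of_ne (ha.2 c ?_) fun e => hn.1 (e ▸ hc)⟩
    exact (Equiv.Perm.mem_toList_iff.1 (h ▸ List.mem_cons_of_mem _ hc)).1

theorem standardCycleForm_cons {τ : Equiv.Perm (Fin n)} :
    ∀ c ∈ standardCycleForm τ, ∃ a t, c = a :: t ∧ ∀ b ∈ t, a < b := by
  intro c hc
  rw [standardCycleForm_eq, List.mem_map] at hc
  obtain ⟨a, ha, rfl⟩ := hc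
  exact ⟨a, toList_of_mem_cycleMinima ha⟩

theorem nodup_flatten_standardCycleForm (τ : Equiv.Perm (Fin n)) :
    (standardCycleForm τ).flatten.Nodup := by
  rw [List.nodup_flatten, standardCycleForm_eq, List.pairwise_map]
  refine ⟨fun c hc => ?_, (pairwise_cycleMinima τ).imp_of_mem fun {a b} ha hb hab c hca hcb => ?_⟩
  · obtain ⟨a, -, rfl⟩ := List.mem_map.1 hc
    exact τ.nodup_toList a
  · rw [Equiv.Perm.mem_toList_iff] at hca hcb
    exact absurd ((mem_cycleMinima.1 hb).2 a (hcb.1.trans hca.1.symm)) (not_le.2 hab)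

theorem mem_flatten_standardCycleForm {τ : Equiv.Perm (Fin n)} {x : Fin n} :
    x ∈ (standardCycleForm τ).flatten ↔ x ∈ τ.support := by
  rw [standardCycleForm_eq, List.mem_flatten]
  constructor
  · rintro ⟨c, hc, hx⟩
    obtain ⟨a, -, rfl⟩ := List.mem_map.1 hc
    rw [Equiv.Perm.mem_toList_iff] at hx
    exact hx.1.mem_support_iff.1 hx.2
  -- The cycle containing `x` is listed under its minimum.
  · intro hx
    obtain ⟨a, ha, hmin⟩ := Finset.exists_min_image (Finset.univ.filter fun a => τ.SameCycle a x) id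
      ⟨x, by simp [Equiv.Perm.SameCycle.refl]⟩
    simp only [Finset.mem_filter, Finset.mem_univ, true_and, id] at ha hmin
    have hs : a ∈ τ.support := ha.mem_support_iff.2 hx
    refine ⟨_, List.mem_map_of_mem (mem_cycleMinima.2 ⟨Equiv.Perm.mem_support.1 hs, fun b hb => ?_⟩),
      Equiv.Perm.mem_toList_iff.2 ⟨ha, hs⟩⟩
    exact hmin b (hb.symm.trans ha)

theorem blocks_map_of_pairwise {f : Fin n → List (Fin n)} {l : List (Fin n)}
    (hl : l.Pairwise (· > ·)) (hf : ∀ a ∈ l, ∃ t, f a = a :: t ∧ ∀ b ∈ t, a < b) :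
    Blocks (· < ·) (l.map f) := by
  induction l with
  | nil => exact .nil
  | cons a l ih =>
    obtain ⟨t, ht, hlt⟩ := hf a (by simp)
    rw [List.pairwise_cons] at hl
    rw [List.map_cons, ht]
    refine .cons _ _ _ hlt ?_ (ih hl.2 fun a ha => hf a (by simp [ha]))
    cases l with
    | nil => simp
    | cons b l =>
      obtain ⟨u, hu, -⟩ := hf b (by simp)
      simpa [hu] using (hl.1 b (by simp)).le

/-- Once reversed, the minima decrease: a letter above the current minimum continues the cycle, and
a smaller one opens the next. -/
theorem blocks_reverse_standardCycleForm (τ : Equiv.Perm (Fin n)) :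
    Blocks (· < ·) (standardCycleForm τ).reverse := by
  rw [standardCycleForm_eq, ← List.map_reverse]
  refine blocks_map_of_pairwise (List.pairwise_reverse.2 (pairwise_cycleMinima τ)) fun a ha => ?_
  exact toList_of_mem_cycleMinima (List.mem_reverse.1 ha)

theorem standardCycleForm_injective : Function.Injective (standardCycleForm (n := n)) := by
  intro τ σ h
  ext1 x
  have hsupp : x ∈ τ.support ↔ x ∈ σ.support := by
    rw [← mem_flatten_standardCycleForm, h, mem_flatten_standardCycleForm]
  by_cases hx : x ∈ τ.support
  · obtain ⟨c, hc, hxc⟩ := List.mem_flatten.1 (mem_flatten_standardCycleForm.2 hx)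
    have hc' := h ▸ hc
    rw [standardCycleForm_eq, List.mem_map] at hc hc'
    obtain ⟨a, ha, rfl⟩ := hc
    obtain ⟨b, hb, e⟩ := hc'
    obtain ⟨t, ht, -⟩ := toList_of_mem_cycleMinima ha
    obtain ⟨u, hu, -⟩ := toList_of_mem_cycleMinima hb
    obtain rfl : b = a := by
      rw [ht, hu, List.cons.injEq] at e
      exact e.1
    have h1 := Equiv.Perm.next_toList_eq_apply τ b x hxc
    have h2 := Equiv.Perm.next_toList_eq_apply σ b x (e ▸ hxc)
    rw [← h1, ← h2]
    simp only [e]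
  · rw [Equiv.Perm.notMem_support.1 hx, Equiv.Perm.notMem_support.1 (mt hsupp.2 hx)]

/-! ### The chains of the permutations -/

theorem exists_xChain_eq (τ : Equiv.Perm (Fin n)) :
    ∃ L : List (Quantity n), (∀ Q ∈ L, Q.Good) ∧ L.map Quantity.word = standardCycleForm τ ∧
      xChain τ = prodExpand L := by
  obtain ⟨hg, hw⟩ := run_starCycle standardCycleForm_cons (nodup_flatten_standardCycleForm τ)
    (le_refl ((standardCycleForm τ).flatMap starCycle).length)
  refine ⟨(finalString τ).map Prod.snd, fun Q hQ => ?_, ?_, ?_⟩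
  · obtain ⟨p, hp, rfl⟩ := List.mem_map.1 hQ
    exact hg p hp
  · rw [List.map_map, ← hw]
    rfl
  · rw [prodExpand, List.map_map]
    rfl

/-- The leading word of `xChain τ`. -/
def leadWord (τ : Equiv.Perm (Fin n)) : List (Fin n) :=
  (standardCycleForm τ).reverse.flatten.reverse

theorem leadWord_injective : Function.Injective (leadWord (n := n)) := fun τ σ h =>
  standardCycleForm_injective <| List.reverse_injective <|
    (blocks_reverse_standardCycleForm τ).eq_of_flatten_eq (blocks_reverse_standardCycleForm σ)
      (List.reverse_injective h)

theorem lead_xChain (τ : Equiv.Perm (Fin n)) : Lead (leadWord τ) (xChain τ) := by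
  obtain ⟨L, hg, hw, e⟩ := exists_xChain_eq τ
  have := lead_prodExpand hg (by
    rw [List.flatMap_def, hw]
    exact nodup_flatten_standardCycleForm τ)
  rw [e, leadWord, ← hw, List.reverse_flatten]
  simpa [List.flatMap_def, Function.comp_def] using this

theorem linearIndependent_xChain : LinearIndependent ℝ (xChain (n := n)) :=
  linearIndependent_of_lead leadWord_injective lead_xChain

theorem xChain_mem_homog (τ : Equiv.Perm (Fin n)) : xChain τ ∈ homog τ.support := by
  have : (leadWord τ).toFinset = τ.support := by
    ext x
    rw [← mem_flatten_standardCycleForm]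
    simp [leadWord]
  exact this ▸ (lead_xChain τ).mem_homog

theorem deletion_xChain {τ : Equiv.Perm (Fin n)} {a : Fin n} (ha : a ∈ τ.support) :
    deletion a (xChain τ) = 0 := by
  obtain ⟨L, hg, hw, e⟩ := exists_xChain_eq τ
  rw [e]
  refine deletion_prodExpand hg ?_ ?_ ?_
  · rw [List.flatMap_def, hw]
    exact nodup_flatten_standardCycleForm τ
  · intro Q hQ hl
    have h := List.mem_map_of_mem (f := Quantity.word) hQ
    rw [hw, standardCycleForm_eq, List.mem_map] at h
    obtain ⟨b, -, h⟩ := h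
    obtain ⟨c, hc⟩ := List.length_eq_one_iff.1 hl
    -- Cycles in standard form have at least two letters, so the exceptional case of
    -- `deletion_expand` does not arise.
    exact Equiv.Perm.toList_ne_singleton τ b c (h.trans hc)
  · rw [List.flatMap_def, hw]
    exact mem_flatten_standardCycleForm.2 ha

theorem mem_H {A : Finset (Fin n)} {x : Chain n} :
    x ∈ H A ↔ x ∈ homog A ∧ ∀ a ∈ A, deletion a x = 0 := by
  simp [H, homog]

theorem xChain_mem_H (τ : Equiv.Perm (Fin n)) : xChain τ ∈ H τ.support :=
  mem_H.2 ⟨xChain_mem_homog τ, fun _ ha => deletion_xChain ha⟩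

/-! ### A basis of the chains of given content -/

/-- The word of the letters of `A`, in increasing order. -/
def sortedWord (A : Finset (Fin n)) : InjWord n :=
  ⟨(List.finRange n).filter (· ∈ A), (List.nodup_finRange n).filter _⟩

theorem content_sortedWord (A : Finset (Fin n)) : (sortedWord A).content = A := by
  ext a
  simp [sortedWord, InjWord.content]

theorem delete_sortedWord (A : Finset (Fin n)) (a : Fin n) :
    (sortedWord A).delete a = sortedWord (A.erase a) := by
  apply Subtype.ext
  simp only [InjWord.delete, sortedWord]
  rw [((List.nodup_finRange n).filter _).erase_eq_filter, List.filter_filter]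
  refine List.filter_congr fun b _ => ?_
  by_cases h : b = a <;> simp [h]

/-- The chain `xChain τ`, followed by the letters of `A` that `τ` fixes. -/
noncomputable def extChain (A : Finset (Fin n)) (τ : Equiv.Perm (Fin n)) : Chain n :=
  concat (xChain τ) (Finsupp.single (sortedWord (A \ τ.support)) 1)

theorem extChain_mem_homog {A : Finset (Fin n)} {τ : Equiv.Perm (Fin n)} (h : τ.support ⊆ A) :
    extChain A τ ∈ homog A := by
  have := concat_mem_homog Finset.disjoint_sdiff (xChain_mem_homog τ)
    (single_mem_homog (content_sortedWord (A \ τ.support)) 1)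
  rwa [Finset.union_sdiff_of_subset h] at this

theorem extChain_support (τ : Equiv.Perm (Fin n)) : extChain τ.support τ = xChain τ := by
  have : sortedWord (τ.support \ τ.support) = ⟨[], List.nodup_nil⟩ := by
    apply Subtype.ext
    simp [sortedWord]
  rw [extChain, this]
  exact concat_unit _

theorem deletion_extChain (A : Finset (Fin n)) (τ : Equiv.Perm (Fin n)) (a : Fin n) :
    deletion a (extChain A τ) = if a ∈ τ.support then 0 else extChain (A.erase a) τ := by
  rw [extChain, deletion_concat Finset.disjoint_sdiff a (xChain_mem_homog τ)
    (single_mem_homog (content_sortedWord (A \ τ.support)) 1)]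
  split_ifs with ha
  · rw [deletion_xChain ha, zero_concat]
  · rw [deletion_of_notMem ha (xChain_mem_homog τ), deletion_single, delete_sortedWord, extChain,
      Finset.erase_sdiff_comm]

/-- Delete a letter `a` of `A` fixed by `τ`: the terms whose permutation moves `a` die, the others
become the corresponding chains for `A.erase a`, and induction applies to this vanishing sum. -/
theorem coeff_eq_zero_of_deletion {A : Finset (Fin n)} {c : Equiv.Perm (Fin n) → ℝ}
    (hc : ∀ τ, ¬ τ.support ⊆ A → c τ = 0)
    (hdel : ∀ a ∈ A, deletion a (∑ τ, c τ • extChain A τ) = 0)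
    (τ : Equiv.Perm (Fin n)) (hτ : τ.support ≠ A) : c τ = 0 := by
  induction A using Finset.strongInduction generalizing c τ with
  | H A ih =>
    by_cases hsub : τ.support ⊆ A
    swap
    · exact hc τ hsub
    obtain ⟨a, haA, haτ⟩ := Finset.exists_of_ssubset (hsub.ssubset_of_ne hτ)
    set c' : Equiv.Perm (Fin n) → ℝ := fun σ => if a ∈ σ.support then 0 else c σ with hc'
    have hc'0 : ∀ σ : Equiv.Perm (Fin n), ¬ σ.support ⊆ A.erase a → c' σ = 0 := by
      intro σ hσ
      by_cases h : a ∈ σ.support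
      · simp only [hc', if_pos h]
      · simp only [hc', if_neg h]
        exact hc σ fun hs => hσ (Finset.subset_erase.2 ⟨hs, h⟩)
    have hsum : ∑ σ, c' σ • extChain (A.erase a) σ = 0 := by
      rw [← hdel a haA, map_sum]
      refine Finset.sum_congr rfl fun σ _ => ?_
      rw [map_smul, deletion_extChain]
      by_cases h : a ∈ σ.support <;> simp only [hc', h, if_true, if_false, zero_smul, smul_zero]
    have hne := fun σ => ih (A.erase a) (Finset.erase_ssubset haA) hc'0
      (fun b _ => by rw [hsum, map_zero]) σ
    -- Only permutations of support `A.erase a` survive. For these no letter is appended, so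
    -- independence of the `xChain σ` finishes.
    have hsum' : ∑ σ, c' σ • xChain σ = 0 := by
      rw [← hsum]
      refine Finset.sum_congr rfl fun σ _ => ?_
      by_cases h : σ.support = A.erase a
      · rw [← h, extChain_support]
      · rw [hne σ h, zero_smul, zero_smul]
    have := Fintype.linearIndependent_iff.1 linearIndependent_xChain c' hsum' τ
    simpa only [hc', if_neg haτ] using this

theorem sum_extChain_eq {A : Finset (Fin n)} {c : Equiv.Perm (Fin n) → ℝ}
    (hc : ∀ τ, τ.support ≠ A → c τ = 0) :
    ∑ τ, c τ • extChain A τ = ∑ τ, c τ • xChain τ := by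
  refine Finset.sum_congr rfl fun σ _ => ?_
  by_cases h : σ.support = A
  · rw [← h, extChain_support]
  · rw [hc σ h, zero_smul, zero_smul]

theorem sum_eq_sum_subtype {ι M : Type*} [Fintype ι] [AddCommMonoid M] (p : ι → Prop)
    [DecidablePred p] {f : ι → M} (h : ∀ i, ¬ p i → f i = 0) :
    ∑ i, f i = ∑ i : {i // p i}, f i := by
  rw [← Finset.sum_subtype (Finset.univ.filter p) (by simp) f]
  refine (Finset.sum_subset (Finset.subset_univ _) fun i _ hi => h i ?_).symm
  simpa using hi

theorem exists_sum_extChain_eq (A : Finset (Fin n))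
    (g : {τ : Equiv.Perm (Fin n) // τ.support ⊆ A} → ℝ) :
    ∃ c : Equiv.Perm (Fin n) → ℝ, (∀ τ, ¬ τ.support ⊆ A → c τ = 0) ∧ (∀ τ, c τ.1 = g τ) ∧
      ∑ τ, c τ • extChain A τ = ∑ τ, g τ • extChain A τ.1 := by
  refine ⟨fun τ => if h : τ.support ⊆ A then g ⟨τ, h⟩ else 0, fun τ hτ => dif_neg hτ,
    fun τ => dif_pos τ.2, ?_⟩
  rw [sum_eq_sum_subtype (fun τ : Equiv.Perm (Fin n) => τ.support ⊆ A)]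
  · exact Finset.sum_congr rfl fun τ _ => by simp only [dif_pos τ.2]
  · intro τ hτ
    simp only [dif_neg hτ, zero_smul]

theorem linearIndependent_extChain (A : Finset (Fin n)) :
    LinearIndependent ℝ fun τ : {τ : Equiv.Perm (Fin n) // τ.support ⊆ A} => extChain A τ.1 := by
  rw [Fintype.linearIndependent_iff]
  intro g hg τ
  obtain ⟨c, hc, hcg, e⟩ := exists_sum_extChain_eq A g
  rw [hg] at e
  have h0 := coeff_eq_zero_of_deletion hc (fun a _ => by rw [e, map_zero])
  rw [← hcg]
  exact Fintype.linearIndependent_iff.1 linearIndependent_xChain c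
    ((sum_extChain_eq h0).symm.trans e) τ.1

theorem finrank_homog_le (A : Finset (Fin n)) :
    Module.Finite ℝ (homog A) ∧ Module.finrank ℝ (homog A) ≤ A.card.factorial := by
  classical
  let e : homog A ≃ₗ[ℝ] ({w : InjWord n | w.content = A} →₀ ℝ) := Finsupp.supportedEquivFinsupp _
  let f : {w : InjWord n | w.content = A} → (sortedWord A).1.permutations.toFinset := fun w =>
    ⟨w.1.1, by
      rw [List.mem_toFinset, List.mem_permutations, List.perm_ext_iff_of_nodup w.1.2 (sortedWord A).2]
      intro a
      rw [← List.mem_toFinset, ← List.mem_toFinset]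
      exact Finset.ext_iff.1 (w.2.trans (content_sortedWord A).symm) a⟩
  have hf : Function.Injective f := fun u v h => by
    have h' : (f u).1 = (f v).1 := by rw [h]
    exact Subtype.ext (Subtype.ext h')
  have := Fintype.ofInjective f hf
  refine ⟨Module.Finite.equiv e.symm, ?_⟩
  rw [e.finrank_eq, Module.finrank_finsupp_self]
  refine (Fintype.card_le_of_injective f hf).trans ?_
  rw [Fintype.card_coe]
  refine (List.toFinset_card_le _).trans ?_
  rw [List.length_permutations, ← card_content, content_sortedWord]

/-- These are the permutations of `A`. Their number bounds the dimension of the chains of content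
`A`, so independence of the `extChain A τ` suffices for spanning. -/
theorem card_support_subset (A : Finset (Fin n)) :
    Fintype.card {τ : Equiv.Perm (Fin n) // τ.support ⊆ A} = A.card.factorial := by
  rw [← Fintype.card_coe A, ← Fintype.card_perm]
  refine Fintype.card_congr ((Equiv.subtypeEquivRight fun τ => ?_).trans
    (Equiv.Perm.subtypeEquivSubtypePerm (· ∈ A)).symm)
  constructor
  · intro h a ha
    by_contra hne
    exact ha (h (Equiv.Perm.mem_support.2 hne))
  · intro h a ha
    by_contra hne
    exact Equiv.Perm.mem_support.1 ha (h a hne)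

theorem span_extChain (A : Finset (Fin n)) :
    Submodule.span ℝ (Set.range fun τ : {τ : Equiv.Perm (Fin n) // τ.support ⊆ A} =>
      extChain A τ.1) = homog A := by
  obtain ⟨_, h⟩ := finrank_homog_le A
  refine Submodule.eq_of_le_of_finrank_le (Submodule.span_le.2 ?_) ?_
  · rintro _ ⟨τ, rfl⟩
    exact extChain_mem_homog τ.2
  · rwa [finrank_span_eq_card (linearIndependent_extChain A), card_support_subset]

theorem exists_sum_xChain_of_mem_H {A : Finset (Fin n)} {x : Chain n} (hx : x ∈ H A) :
    ∃ c : Equiv.Perm (Fin n) → ℝ, (∀ τ, τ.support ≠ A → c τ = 0) ∧ x = ∑ τ, c τ • xChain τ := by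
  rw [mem_H] at hx
  have hs := hx.1
  rw [← span_extChain] at hs
  obtain ⟨g, hg⟩ := (Submodule.mem_span_range_iff_exists_fun ℝ).1 hs
  obtain ⟨c, hc, -, e⟩ := exists_sum_extChain_eq A g
  rw [hg] at e
  have h0 := coeff_eq_zero_of_deletion hc (fun a ha => by rw [e]; exact hx.2 a ha)
  exact ⟨c, h0, e.symm.trans (sum_extChain_eq h0)⟩

end RankingWavelets

/-! ### The basis of `H_A` -/

theorem mainTheorem3 (n : ℕ) (A : Finset (Fin n)) (hA : 2 ≤ A.card) :
    ∃ b : Module.Basis {τ : Equiv.Perm (Fin n) // τ.support = A} ℝ (RankingWavelets.H A),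
      ∀ τ, (b τ : RankingWavelets.Chain n) = RankingWavelets.xChain τ.1 := by
  let v : {τ : Equiv.Perm (Fin n) // τ.support = A} → RankingWavelets.H A := fun τ =>
    ⟨RankingWavelets.xChain τ.1, by
      have := RankingWavelets.xChain_mem_H τ.1
      rwa [τ.2] at this⟩
  have hli : LinearIndependent ℝ v := by
    refine LinearIndependent.of_comp (RankingWavelets.H A).subtype ?_
    exact RankingWavelets.linearIndependent_xChain.comp _ Subtype.val_injective
  have hsp : ⊤ ≤ Submodule.span ℝ (Set.range v) := by
    rintro ⟨x, hx⟩ -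
    obtain ⟨c, hc, rfl⟩ := RankingWavelets.exists_sum_xChain_of_mem_H hx
    have e : (⟨∑ τ, c τ • RankingWavelets.xChain τ, hx⟩ : RankingWavelets.H A) =
        ∑ τ : {τ : Equiv.Perm (Fin n) // τ.support = A}, c τ.1 • v τ := by
      apply Subtype.ext
      rw [Submodule.coe_sum]
      change ∑ τ, c τ • RankingWavelets.xChain τ =
        ∑ τ : {τ : Equiv.Perm (Fin n) // τ.support = A}, c τ.1 • RankingWavelets.xChain τ.1
      refine RankingWavelets.sum_eq_sum_subtype (fun τ : Equiv.Perm (Fin n) => τ.support = A) ?_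
      intro τ hτ
      rw [hc τ hτ, zero_smul]
    rw [e]
    exact Submodule.sum_mem _ fun τ _ =>
      Submodule.smul_mem _ _ (Submodule.subset_span (Set.mem_range_self τ))
  exact ⟨Module.Basis.mk hli hsp, fun τ => by rw [Module.Basis.mk_apply]⟩
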